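/- Let $X,Y$ be real Banach spaces, $A\colon X\to Y$ a bounded linear operator, $\mathcal R\colon X\to[0,+\infty]$ convex, lower semi-continuous and coercive, and $p>1$; for $r>1$ write $r_*$ for the conjugate exponent, $1/r+1/r_*=1$. Assume that $Y$ is $p$-smooth, i.e. there is $K>0$ such that $\sup\{(\|y+z\|+\|y-z\|)/2-1 : \|y\|=1,\ \|z\|=\tau\}\le K\tau^p$ for all sufficiently small $\tau>0$. Let $y^\dagger\in Y$, let $x^\dagger$ be an $\mathcal R$-minimising solution of $Ax=y^\dagger$, and let $\omega^\dagger\in Y^*$ satisfy $A^*\omega^\dagger\in\partial\mathcal R(x^\dagger)$. Put $$\mathcal D_{A^*\omega^\dagger}(x;x^\dagger)=\mathcal R(x)-\mathcal R(x^\dagger)-\langle A^*\omega^\dagger,x-x^\dagger\rangle,$$ $$\mathcal D^*_{x^\dagger}(\xi;A^*\omega^\dagger)=\mathcal R^*(\xi)-\mathcal R^*(A^*\omega^\dagger)-\langle \xi-A^*\omega^\dagger,x^\dagger\rangle,$$ where $\mathcal R^*(\xi)=\sup_x(\langle\xi,x\rangle-\mathcal R(x))$. Let $\Phi\colon[0,\infty)\to[0,\infty)$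 be an index function (strictly increasing, continuous, concave, $\Phi(0)=0$; put $\Phi(+\infty)=+\infty$) such that $$\langle\omega^\dagger-\omega,\,J_{p_*}(\omega^\dagger)\rangle\le\Phi\bigl(\mathcal D^*_{x^\dagger}(A^*\omega;A^*\omega^\dagger)\bigr)\qquad\text{for every }\omega\in Y^*,$$ where $J_{p_*}(\omega^\dagger)$ denotes some element $y\in Y$ with $\langle\omega^\dagger,y\rangle=\|\omega^\dagger\|\,\|y\|$ and $\|y\|=\|\omega^\dagger\|^{p_*-1}$. Let $\Psi(s)=\sup_t\,(st-\Phi^{-1}(t))$ be the convex conjugate of $\Phi^{-1}$, where $\Phi^{-1}=+\infty$ outside the range of $\Phi$. Then for every $\alpha>0$ and every minimiser $x_\alpha$ over $X$ of $x\mapsto\frac1p\|Ax-y^\dagger\|^p+\alpha\mathcal R(x)$ (exact data), $$\mathcal D_{A^*\omega^\dagger}(x_\alpha;x^\dagger)\le\Psi(\alpha^{p_*-1}).$$ If moreover $\Phi(t)=c\,t^{1/q_*}$ for all $t\ge0$, with some $c>0$, $q_*>1$ and $1/q+1/q_*=1$, then $$\mathcal D_{A^*\omega^\dagger}(x_\alpha;x^\dagger)\le\frac{c^q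 q_*^{1-q}}{q}\,\alpha^{(p_*-1)q}.$$ -/

import Mathlib

open Filter Topology Set
open scoped ENNReal NNReal

noncomputable section

namespace TikhonovBanach

section Regularisation

variable {X Y : Type*} [NormedAddCommGroup X] [NormedSpace ℝ X]
  [NormedAddCommGroup Y] [NormedSpace ℝ Y]

/-- `R` is convex, lower semi-continuous and coercive (`R x → ∞` as `‖x‖ → ∞`). -/
structure IsRegulariser (R : X → ℝ≥0∞) : Prop where
  convex : ConvexOn ℝ≥0 univ R
  lsc : LowerSemicontinuous R
  coercive : Tendsto R (Bornology.cobounded X) (𝓝 ⊤)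

/-- The Tikhonov functional `T_α(x; y) = (1/p) ‖A x - y‖ ^ p + α R(x)`. -/
def tikhonov (A : X →L[ℝ] Y) (R : X → ℝ≥0∞) (p α : ℝ) (y : Y) (x : X) : ℝ≥0∞ :=
  ENNReal.ofReal (1 / p * ‖A x - y‖ ^ p) + ENNReal.ofReal α * R x

/-- `x` is an `R`-minimising solution of the equation `A x = y`. -/
def IsMinimisingSolution (A : X →L[ℝ] Y) (R : X → ℝ≥0∞) (y : Y) (x : X) : Prop :=
  A x = y ∧ ∀ z, A z = y → R x ≤ R z

/-- `x` minimises the Tikhonov functional `T_α(·; y)` over the whole of `X`. -/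
def IsTikhonovMinimiser (A : X →L[ℝ] Y) (R : X → ℝ≥0∞) (p α : ℝ) (y : Y) (x : X) : Prop :=
  ∀ z, tikhonov A R p α y x ≤ tikhonov A R p α y z

/-- The sub-differential `∂R(x)`; as usual it is empty where `R x = ∞`. -/
def subdifferential (R : X → ℝ≥0∞) (x : X) : Set (StrongDual ℝ X) :=
  {ξ | R x ≠ ⊤ ∧ ∀ z, (R x : EReal) + ((ξ (z - x) : ℝ) : EReal) ≤ (R z : EReal)}

/-- The Bregman distance `D_ξ(z; x) = R(z) - R(x) - ⟨ξ, z - x⟩`, used for `ξ ∈ ∂R(x)`. -/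
def bregman (R : X → ℝ≥0∞) (ξ : StrongDual ℝ X) (z x : X) : EReal :=
  (R z : EReal) - (R x : EReal) - ((ξ (z - x) : ℝ) : EReal)

/-- The convex dual `R*(ξ) = sup_x (⟨ξ, x⟩ - R(x))`. -/
def dualFunctional (R : X → ℝ≥0∞) (ξ : StrongDual ℝ X) : EReal :=
  ⨆ x : X, ((ξ x : ℝ) : EReal) - (R x : EReal)

/-- The dual Bregman distance `D*_x(ξ; η) = R*(ξ) - R*(η) - ⟨ξ - η, x⟩`,
used for `η ∈ ∂R(x)`. -/
def dualBregman (R : X → ℝ≥0∞) (x : X) (ξ η : StrongDual ℝ X) : EReal :=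
  dualFunctional R ξ - dualFunctional R η - (((ξ - η) x : ℝ) : EReal)

/-- The (set-valued) adjoint duality mapping `Y* → 2^Y` with exponent `r`. -/
def adjointDualityMap (r : ℝ) (ω : StrongDual ℝ Y) : Set Y :=
  {y | ω y = ‖ω‖ * ‖y‖ ∧ ‖y‖ = ‖ω‖ ^ (r - 1)}

end Regularisation

section Smoothness

variable (Y : Type*) [NormedAddCommGroup Y]

/-- The modulus of smoothness `ρ_Y(τ)`. -/
def modulusOfSmoothness (τ : ℝ) : ℝ :=
  sSup {s | ∃ y z : Y, ‖y‖ = 1 ∧ ‖z‖ = τ ∧ s = (‖y + z‖ + ‖y - z‖) / 2 - 1}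

/-- `Y` is `r`-smooth: `ρ_Y(τ) ≤ K τ ^ r` for all sufficiently small `τ > 0`. -/
def IsPowerSmooth (r : ℝ) : Prop :=
  ∃ K : ℝ, 0 < K ∧ ∀ᶠ τ in 𝓝[>] (0 : ℝ), modulusOfSmoothness Y τ ≤ K * τ ^ r

end Smoothness

/-- Index functions on `[0, ∞)`: strictly increasing, continuous, concave, zero at zero.
Only the values of `Φ` on `[0, ∞)` matter. -/
structure IsIndexFunction (Φ : ℝ → ℝ) : Prop where
  strictMono : StrictMonoOn Φ (Ici 0)
  continuous : ContinuousOn Φ (Ici 0)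
  concave : ConcaveOn ℝ (Ici 0) Φ
  map_zero : Φ 0 = 0

/-- The inverse of `Φ : [0, ∞) → [0, ∞)` as a convex function on the real line:
the value at `t` is the `r ≥ 0` with `Φ r = t`, and `+∞` if there is none. -/
def indexInverse (Φ : ℝ → ℝ) (t : ℝ) : EReal :=
  ⨅ (r : ℝ) (_ : 0 ≤ r ∧ Φ r = t), (r : EReal)

/-- The convex conjugate `g*(s) = sup_t (s t - g(t))` on the real line. -/
def conjugate (g : ℝ → EReal) (s : ℝ) : EReal :=
  ⨆ t : ℝ, ((s * t : ℝ) : EReal) - g t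

/-- The variational inequality for the dual functional:
`⟨ω† - ω, J⟩ ≤ Φ(D*_{x†}(A* ω; A* ω†))` for every `ω ∈ Y*`, with `J ∈ J_r(ω†)`.
It is no restriction on the `ω` whose dual Bregman distance is infinite (`Φ(+∞) = +∞`).
If the duality mapping is multi-valued at `ω†`, one element `J` suffices. -/
def DualVariationalInequality {X Y : Type*} [NormedAddCommGroup X] [NormedSpace ℝ X]
    [NormedAddCommGroup Y] [NormedSpace ℝ Y] (A : X →L[ℝ] Y) (R : X → ℝ≥0∞) (r : ℝ)
    (xd : X) (ωd : StrongDual ℝ Y) (Φ : ℝ → ℝ) : Prop :=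
  ∃ J ∈ adjointDualityMap r ωd, ∀ ω : StrongDual ℝ Y,
    dualBregman R xd (ω.comp A) (ωd.comp A) ≠ ⊤ →
      (ωd - ω) J ≤ Φ (dualBregman R xd (ω.comp A) (ωd.comp A)).toReal

end TikhonovBanach

end

namespace TikhonovBanach

/-! The optimality condition at a Tikhonov minimiser `x` yields `ω` with `A* ω ∈ ∂R(x)` such that
the residual `w = A x† - A x` is `α ^ (p_* - 1)` times an element of `J_{p_*}(ω)`. Fenchel equality
at `x` and `x†` turns the dual Bregman distance into `d = R(x†) - R(x) - ⟨ω, w⟩`, so the primal one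
is exactly `⟨ω† - ω, w⟩ - d`. Monotonicity of the duality mapping allows `w` to be replaced by `α ^
(p_* - 1) J`, and the variational inequality then gives the bound `α ^ (p_* - 1) Φ(d) - d`
(`exists_bregman_le`). The conjugate dominates this at `t = Φ(d)`; for power functions, Young's
inequality does. -/

/-- Subdifferential sum rule: if `g ∘ A + φ` attains its minimum over `D` at `x₀`, with `g`
continuous and convex, then some subgradient `f` of `g` at `A x₀` satisfies
`-A* f ∈ ∂φ(x₀)`. -/
theorem exists_subgradient_of_minimiser {X Y : Type*} [NormedAddCommGroup X] [NormedSpace ℝ X]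
    [NormedAddCommGroup Y] [NormedSpace ℝ Y] (A : X →L[ℝ] Y) {g : Y → ℝ}
    (hg : ConvexOn ℝ univ g) (hgc : Continuous g) {D : Set X} {φ : X → ℝ} (hφ : ConvexOn ℝ D φ)
    {x₀ : X} (hx₀ : x₀ ∈ D) (hmin : ∀ x ∈ D, g (A x₀) + φ x₀ ≤ g (A x) + φ x) :
    ∃ f : StrongDual ℝ Y, (∀ v, g (A x₀) + f (v - A x₀) ≤ g v) ∧
      ∀ x ∈ D, φ x₀ - f (A (x - x₀)) ≤ φ x := by
  set T := g (A x₀) + φ x₀ with hT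
  -- The strict epigraph of `g` and the hypograph of `T - φ` pushed forward by `A`; minimality at
  -- `x₀` makes them disjoint.
  let S₁ : Set (Y × ℝ) := {q | g q.1 < q.2}
  let S₂ : Set (Y × ℝ) := {q | ∃ x ∈ D, A x = q.1 ∧ q.2 ≤ T - φ x}
  have hS₁ : Convex ℝ S₁ := by simpa [S₁] using hg.convex_strict_epigraph
  have hS₁o : IsOpen S₁ := isOpen_lt (hgc.comp continuous_fst) continuous_snd
  have hS₂ : Convex ℝ S₂ := by
    rintro ⟨v, s⟩ ⟨x, hx, hxv, hs⟩ ⟨v', s'⟩ ⟨x', hx', hxv', hs'⟩ a b ha hb hab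
    refine ⟨a • x + b • x', hφ.1 hx hx' ha hb hab, by simp_all, ?_⟩
    have h := hφ.2 hx hx' ha hb hab
    simp only [smul_eq_mul] at h
    simp only [Prod.smul_mk, Prod.mk_add_mk, smul_eq_mul] at hs hs' ⊢
    have h1 := mul_le_mul_of_nonneg_left hs ha
    have h2 := mul_le_mul_of_nonneg_left hs' hb
    have h3 : T = a * T + b * T := by rw [← add_mul, hab, one_mul]
    linarith
  have hdisj : Disjoint S₁ S₂ := by
    rw [Set.disjoint_left]
    rintro ⟨v, s⟩ h ⟨x, hx, hxv, hs⟩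
    have := hmin x hx
    simp only [S₁, mem_ofPred_eq] at h hs hxv
    rw [hxv] at this
    linarith
  obtain ⟨F, u, h₁, h₂⟩ := geometric_hahn_banach_open hS₁ hS₁o hS₂ hdisj
  let k : StrongDual ℝ Y := F.comp (ContinuousLinearMap.inl ℝ Y ℝ)
  let l : ℝ := F (0, 1)
  have hF : ∀ v t, F (v, t) = k v + t * l := by
    intro v t
    have : (v, t) = (v, (0 : ℝ)) + t • ((0 : Y), (1 : ℝ)) := by simp
    rw [this, map_add, map_smul]
    simp [k, l]
  have hlt : ∀ v t, g v < t → k v + t * l < u := fun v t h => hF v t ▸ h₁ (v, t) h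
  have hle : ∀ x ∈ D, u ≤ k (A x) + (T - φ x) * l := fun x hx =>
    hF _ _ ▸ h₂ (A x, T - φ x) ⟨x, hx, rfl, le_rfl⟩
  -- The separating hyperplane is not vertical: `S₂` contains `(A x₀, g (A x₀))` and `S₁` the points
  -- directly above it.
  have hl : l < 0 := by
    have h3 := hle x₀ hx₀
    have h4 := hlt (A x₀) (g (A x₀) + 1) (by linarith)
    have : T - φ x₀ = g (A x₀) := by rw [hT]; ring
    rw [this] at h3
    linarith
  have hclos : ∀ v, k v + g v * l ≤ u := by
    intro v
    refine le_of_forall_pos_lt_add fun ε hε => ?_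
    have h5 := hlt v (g v + ε / (-l)) (by have := div_pos hε (neg_pos.2 hl); linarith)
    have : ε / (-l) * l = -ε := by rw [div_neg, neg_mul, div_mul_cancel₀ ε hl.ne]
    rw [add_mul, this] at h5
    linarith
  -- `S₂` and the closure of `S₁` meet over `A x₀`, which fixes the level `u`; dividing by `-l` then
  -- normalises the functional.
  have hu : u = k (A x₀) + g (A x₀) * l := by
    apply le_antisymm
    · have h3 := hle x₀ hx₀
      have : T - φ x₀ = g (A x₀) := by rw [hT]; ring
      rwa [this] at h3
    · exact hclos _
  have hl' : 0 < -l := neg_pos.2 hl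
  refine ⟨(-l)⁻¹ • k, fun v => ?_, fun x hx => ?_⟩
  · have h6 := hclos v
    have h7 : (-l)⁻¹ * (k v - k (A x₀)) ≤ g v - g (A x₀) := by
      rw [inv_mul_le_iff₀ hl']; linarith
    simp only [smul_apply, map_sub, smul_eq_mul]
    linarith
  · have h6 := hle x hx
    have h7 : φ x₀ - φ x ≤ (-l)⁻¹ * (k (A x) - k (A x₀)) := by
      rw [le_inv_mul_iff₀ hl']
      rw [hu, hT] at h6
      linarith
    simp only [smul_apply, map_sub, smul_eq_mul]
    linarith

theorem convexOn_toReal_of_convexOn {X : Type*} [AddCommGroup X] [Module ℝ X] {R : X → ℝ≥0∞}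
    (hR : ConvexOn ℝ≥0 univ R) : ConvexOn ℝ {x | R x ≠ ⊤} fun x => (R x).toReal := by
  have key : ∀ ⦃x⦄, R x ≠ ⊤ → ∀ ⦃z⦄, R z ≠ ⊤ → ∀ ⦃a b : ℝ⦄, 0 ≤ a → 0 ≤ b → a + b = 1 →
      R (a • x + b • z) ≤ ENNReal.ofReal (a * (R x).toReal + b * (R z).toReal) := by
    intro x hx z hz a b ha hb hab
    lift a to ℝ≥0 using ha
    lift b to ℝ≥0 using hb
    refine (hR.2 (mem_univ x) (mem_univ z) zero_le zero_le (by exact_mod_cast hab)).trans ?_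
    rw [ENNReal.ofReal_add (by positivity) (by positivity), ENNReal.ofReal_mul (by positivity),
      ENNReal.ofReal_mul (by positivity), ENNReal.ofReal_toReal hx, ENNReal.ofReal_toReal hz]
    simp [ENNReal.smul_def]
  refine ⟨fun x hx z hz a b ha hb hab => ne_top_of_le_ne_top ENNReal.ofReal_ne_top
    (key hx hz ha hb hab), fun x hx z hz a b ha hb hab => ?_⟩
  exact ENNReal.toReal_le_of_le_ofReal (by positivity) (key hx hz ha hb hab)

section

variable {X Y : Type*} [NormedAddCommGroup X] [NormedSpace ℝ X]
  [NormedAddCommGroup Y] [NormedSpace ℝ Y]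

/-! ### Subgradients of powers of the norm -/

theorem convexOn_norm_sub_rpow {p : ℝ} (hp : 1 ≤ p) (y : Y) :
    ConvexOn ℝ univ fun v : Y => 1 / p * ‖v - y‖ ^ p := by
  have h : ConvexOn ℝ univ fun v : Y => ‖v - y‖ ^ p := by
    refine ⟨convex_univ, fun v _ w _ a b ha hb hab => ?_⟩
    have h1 : ‖a • v + b • w - y‖ ≤ a • ‖v - y‖ + b • ‖w - y‖ := by
      have : a • v + b • w - y = a • (v - y) + b • (w - y) := by
        nth_rewrite 1 [← one_smul ℝ y]
        rw [← hab]
        module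
      rw [this]
      refine (norm_add_le _ _).trans ?_
      rw [norm_smul_of_nonneg ha, norm_smul_of_nonneg hb, smul_eq_mul, smul_eq_mul]
    exact (Real.rpow_le_rpow (norm_nonneg _) h1 (by linarith)).trans
      ((convexOn_rpow hp).2 (norm_nonneg _) (norm_nonneg _) ha hb hab)
  simpa using h.smul (c := 1 / p) (by positivity)

/-- The subgradients of `‖·‖ ^ p / p` at `w` lie in the image of `w` under the duality mapping
with exponent `p`. -/
theorem norm_eq_and_apply_eq_of_subgradient {p : ℝ} (hp : 1 < p) {f : StrongDual ℝ Y} {w : Y}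
    (hf : ∀ v, 1 / p * ‖w‖ ^ p + f (v - w) ≤ 1 / p * ‖v‖ ^ p) :
    ‖f‖ = ‖w‖ ^ (p - 1) ∧ f w = ‖f‖ * ‖w‖ := by
  have hp0 : 0 < p := by linarith
  rcases eq_or_ne w 0 with rfl | hw
  · have hf0 : ∀ v, f v ≤ 0 := by
      intro v
      -- Testing with `t • v` and dividing by `t` bounds `f v` by a multiple of `t ^ (p - 1)`, which
      -- vanishes as `t → 0` because `p > 1`.
      have hlim : Tendsto (fun t : ℝ => t ^ (p - 1) * (1 / p * ‖v‖ ^ p)) (𝓝[>] 0)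
          (𝓝 (0 * (1 / p * ‖v‖ ^ p))) := by
        refine Tendsto.mul_const _ ?_
        have := (Real.continuousAt_rpow_const 0 (p - 1) (Or.inr (by linarith))).tendsto
        rw [Real.zero_rpow (by linarith)] at this
        exact this.mono_left nhdsWithin_le_nhds
      rw [zero_mul] at hlim
      refine ge_of_tendsto hlim ?_
      filter_upwards [self_mem_nhdsWithin] with t ht
      have ht : 0 < t := ht
      have h := hf (t • v)
      rw [norm_smul_of_nonneg ht.le, Real.mul_rpow ht.le (norm_nonneg _), norm_zero,
        Real.zero_rpow hp0.ne', sub_zero, map_smul, smul_eq_mul, mul_zero, zero_add] at h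
      have h2 : t ^ p = t * t ^ (p - 1) := by
        rw [← Real.rpow_one_add' ht.le (by linarith)]; congr 1; ring
      rw [h2] at h
      refine le_of_mul_le_mul_left (h.trans_eq ?_) ht
      ring
    have : f = 0 := by
      ext v
      refine le_antisymm (hf0 v) ?_
      have := hf0 (-v)
      simp only [map_neg] at this
      simpa using this
    subst this
    simp [Real.zero_rpow (by linarith : p - 1 ≠ 0)]
  · have hn : 0 < ‖w‖ := norm_pos_iff.2 hw
    have hwp : ‖w‖ ^ p = ‖w‖ ^ (p - 1) * ‖w‖ := by
      rw [Real.rpow_sub_one hn.ne']; field_simp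
    have hfw : f w = ‖w‖ ^ p := by
      -- On the ray `t • w` the subgradient inequality says that `h` is minimal at `t = 1`; `h' = 0`
      -- there gives `f w`.
      let h : ℝ → ℝ := fun t => t ^ p * (1 / p * ‖w‖ ^ p) - (t - 1) * f w
      have hd : HasDerivAt h (p * 1 ^ (p - 1) * (1 / p * ‖w‖ ^ p) - 1 * f w) 1 :=
        ((Real.hasDerivAt_rpow_const (Or.inl one_ne_zero)).mul_const _).sub
          (((hasDerivAt_id 1).sub_const 1).mul_const _)
      have hm : IsLocalMin h 1 := by
        filter_upwards [lt_mem_nhds (zero_lt_one (α := ℝ))] with t ht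
        have h1 := hf (t • w)
        rw [norm_smul_of_nonneg ht.le, Real.mul_rpow ht.le (norm_nonneg _), map_sub, map_smul,
          smul_eq_mul] at h1
        simp only [h, Real.one_rpow]
        linarith
      have h0 := hm.hasDerivAt_eq_zero hd
      rw [Real.one_rpow] at h0
      field_simp at h0
      linarith
    have hle : ‖f‖ ≤ ‖w‖ ^ (p - 1) := by
      have hball : ∀ v, ‖v‖ ≤ ‖w‖ → f v ≤ ‖w‖ ^ p := by
        intro v hv
        have h1 := hf v
        have h2 : ‖v‖ ^ p ≤ ‖w‖ ^ p := Real.rpow_le_rpow (norm_nonneg _) hv hp0.le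
        have h3 := mul_le_mul_of_nonneg_left h2 (one_div_nonneg.2 hp0.le)
        rw [map_sub, hfw] at h1
        linarith
      refine f.opNorm_le_of_unit_norm (by positivity) fun v hv => ?_
      have hs : ∀ s : ℝ, ‖s‖ = 1 → s * f v ≤ ‖w‖ ^ (p - 1) := by
        intro s hs
        have h1 := hball ((‖w‖ * s) • v) (by simp [norm_smul, hs, hv])
        rw [map_smul, smul_eq_mul, hwp] at h1
        refine le_of_mul_le_mul_left ?_ hn
        linarith
      rw [Real.norm_eq_abs, abs_le']
      exact ⟨by simpa using hs 1 (by simp), by simpa using hs (-1) (by simp)⟩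
    have heq : ‖f‖ = ‖w‖ ^ (p - 1) := by
      refine le_antisymm hle (le_of_mul_le_mul_right ?_ hn)
      rw [← hwp, ← hfw]
      exact f.le_opNorm_of_le le_rfl |>.trans' (Real.le_norm_self _)
    exact ⟨heq, by rw [hfw, heq, hwp]⟩

/-! ### Fenchel equality and the optimality condition -/

theorem toReal_add_le_of_mem_subdifferential {R : X → ℝ≥0∞} {ξ : StrongDual ℝ X} {x z : X}
    (h : ξ ∈ subdifferential R x) (hz : R z ≠ ⊤) :
    (R x).toReal + ξ (z - x) ≤ (R z).toReal := by
  have h1 := h.2 z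
  rw [← EReal.coe_ennreal_toReal h.1, ← EReal.coe_ennreal_toReal hz] at h1
  exact_mod_cast h1

theorem mem_subdifferential_of_toReal {R : X → ℝ≥0∞} {ξ : StrongDual ℝ X} {x : X}
    (hx : R x ≠ ⊤) (h : ∀ z, R z ≠ ⊤ → (R x).toReal + ξ (z - x) ≤ (R z).toReal) :
    ξ ∈ subdifferential R x := by
  refine ⟨hx, fun z => ?_⟩
  by_cases hz : R z = ⊤
  · simp [hz]
  · rw [← EReal.coe_ennreal_toReal hx, ← EReal.coe_ennreal_toReal hz]
    exact_mod_cast h z hz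

/-- Equality in the Fenchel-Young inequality. -/
theorem dualFunctional_eq_of_mem_subdifferential {R : X → ℝ≥0∞} {ξ : StrongDual ℝ X} {x : X}
    (h : ξ ∈ subdifferential R x) :
    dualFunctional R ξ = ((ξ x - (R x).toReal : ℝ) : EReal) := by
  apply le_antisymm
  · refine iSup_le fun z => ?_
    by_cases hz : R z = ⊤
    · simp [hz]
    · have h1 := toReal_add_le_of_mem_subdifferential h hz
      rw [map_sub] at h1
      rw [← EReal.coe_ennreal_toReal hz]
      have : ξ z - (R z).toReal ≤ ξ x - (R x).toReal := by linarith
      exact_mod_cast this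
  · refine le_iSup_of_le x ?_
    rw [← EReal.coe_ennreal_toReal h.1, EReal.coe_sub]

theorem toReal_tikhonov {A : X →L[ℝ] Y} {R : X → ℝ≥0∞} {p α : ℝ} (hp : 0 ≤ p) (hα : 0 ≤ α)
    {y : Y} {x : X} (hx : R x ≠ ⊤) :
    (tikhonov A R p α y x).toReal = 1 / p * ‖A x - y‖ ^ p + α * (R x).toReal := by
  rw [tikhonov, ENNReal.toReal_add ENNReal.ofReal_ne_top
    (ENNReal.mul_ne_top ENNReal.ofReal_ne_top hx), ENNReal.toReal_mul,
    ENNReal.toReal_ofReal (by positivity), ENNReal.toReal_ofReal hα]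

theorem tikhonov_ne_top_iff {A : X →L[ℝ] Y} {R : X → ℝ≥0∞} {p α : ℝ} (hα : 0 < α)
    {y : Y} {x : X} : tikhonov A R p α y x ≠ ⊤ ↔ R x ≠ ⊤ := by
  simp [tikhonov, ENNReal.mul_eq_top, hα]

/-- The optimality condition for Tikhonov minimisers: there is a solution `ω` of the dual
problem. -/
theorem IsTikhonovMinimiser.exists_dual {A : X →L[ℝ] Y} {R : X → ℝ≥0∞}
    (hR : ConvexOn ℝ≥0 univ R) {p α : ℝ} (hp : 1 < p) (hα : 0 < α) {y : Y} {x₀ x : X}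
    (hx₀ : R x₀ ≠ ⊤) (hx : IsTikhonovMinimiser A R p α y x) :
    ∃ ω : StrongDual ℝ Y, ω.comp A ∈ subdifferential R x ∧
      α * ‖ω‖ = ‖y - A x‖ ^ (p - 1) ∧ ω (y - A x) = ‖ω‖ * ‖y - A x‖ := by
  have hp0 : 0 < p := by linarith
  have hxt : R x ≠ ⊤ := (tikhonov_ne_top_iff hα).1
    (ne_top_of_le_ne_top ((tikhonov_ne_top_iff hα).2 hx₀) (hx x₀))
  obtain ⟨f, hf, hfR⟩ := exists_subgradient_of_minimiser A (convexOn_norm_sub_rpow hp.le y)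
    (continuous_const.mul ((continuous_id.sub continuous_const).norm.rpow_const
      fun _ => Or.inr hp0.le))
    ((convexOn_toReal_of_convexOn hR).smul hα.le) hxt (fun z hz => by
      have h := ENNReal.toReal_mono ((tikhonov_ne_top_iff hα).2 hz) (hx z)
      rwa [toReal_tikhonov hp0.le hα.le hxt, toReal_tikhonov hp0.le hα.le hz] at h)
  have hf' : ∀ v, 1 / p * ‖A x - y‖ ^ p + f (v - (A x - y)) ≤ 1 / p * ‖v‖ ^ p := by
    intro v
    have h := hf (v + y)
    rwa [add_sub_cancel_right, show v + y - A x = v - (A x - y) by abel] at h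
  obtain ⟨h1, h2⟩ := norm_eq_and_apply_eq_of_subgradient hp hf'
  -- The dual solution is `-f / α`; the sign turns the residual `A x - y` into `y - A x`.
  have hn : ‖(-α⁻¹) • f‖ = α⁻¹ * ‖f‖ := by
    rw [norm_smul, norm_neg, Real.norm_of_nonneg (by positivity)]
  refine ⟨(-α⁻¹) • f, mem_subdifferential_of_toReal hxt fun z hz => ?_, ?_, ?_⟩
  · have h := hfR z hz
    simp only [smul_eq_mul] at h
    have h3 : (R x).toReal - α⁻¹ * f (A (z - x)) ≤ (R z).toReal := by
      refine le_of_mul_le_mul_left ?_ hα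
      rwa [mul_sub, mul_inv_cancel_left₀ hα.ne']
    simpa [sub_eq_add_neg] using h3
  · rw [hn, mul_inv_cancel_left₀ hα.ne', h1, norm_sub_rev]
  · rw [hn, smul_apply, ← neg_sub, map_neg, h2, norm_neg]
    simp [mul_assoc]

/-- Monotonicity of the duality mapping of `Y*`. -/
theorem apply_le_apply_of_mem_adjointDualityMap {r : ℝ} (hr : 1 ≤ r) {ω ω' : StrongDual ℝ Y}
    {y y' : Y} (hy : y ∈ adjointDualityMap r ω) (hy' : y' ∈ adjointDualityMap r ω') :
    (ω - ω') y' ≤ (ω - ω') y := by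
  have h1 : ω y' ≤ ‖ω‖ * ‖y'‖ := (Real.le_norm_self _).trans (ω.le_opNorm y')
  have h2 : ω' y ≤ ‖ω'‖ * ‖y‖ := (Real.le_norm_self _).trans (ω'.le_opNorm y)
  have h3 : 0 ≤ (‖ω‖ - ‖ω'‖) * (‖y‖ - ‖y'‖) := by
    rw [hy.2, hy'.2]
    rcases le_total ‖ω‖ ‖ω'‖ with h | h
    · exact mul_nonneg_of_nonpos_of_nonpos (sub_nonpos.2 h)
        (sub_nonpos.2 (Real.rpow_le_rpow (norm_nonneg _) h (by linarith)))
    · exact mul_nonneg (sub_nonneg.2 h)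
        (sub_nonneg.2 (Real.rpow_le_rpow (norm_nonneg _) h (by linarith)))
  have h4 := hy.1
  have h5 := hy'.1
  simp only [sub_apply]
  linarith

/-- The Bregman distance of the Tikhonov minimiser is controlled by the dual Bregman distance
`d` of the dual solution. -/
theorem exists_bregman_le {A : X →L[ℝ] Y} {R : X → ℝ≥0∞} (hR : ConvexOn ℝ≥0 univ R)
    {p r : ℝ} (hp : p.HolderConjugate r) {xd : X} {ωd : StrongDual ℝ Y}
    (hωd : ωd.comp A ∈ subdifferential R xd) {Φ : ℝ → ℝ}
    (hvar : DualVariationalInequality A R r xd ωd Φ) {α : ℝ} (hα : 0 < α) {x : X}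
    (hx : IsTikhonovMinimiser A R p α (A xd) x) :
    ∃ d : ℝ, 0 ≤ d ∧
      bregman R (ωd.comp A) x xd ≤ ((α ^ (r - 1) * Φ d - d : ℝ) : EReal) := by
  obtain ⟨J, hJ, hΦ⟩ := hvar
  obtain ⟨ω, hω, hωn, hωr⟩ := hx.exists_dual hR hp.lt hα hωd.1
  set w := A xd - A x with hw
  have hαr : 0 < α ^ (r - 1) := Real.rpow_pos_of_pos hα _
  -- Since `(p - 1) (r - 1) = 1`, raising `α ‖ω‖ = ‖w‖ ^ (p - 1)` to the power `r - 1` recovers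
  -- `‖w‖`.
  have hwJ : (α ^ (r - 1))⁻¹ • w ∈ adjointDualityMap r ω := by
    have hpr : (p - 1) * (r - 1) = 1 := by linarith [hp.mul_eq_add]
    have h1 : ‖w‖ = α ^ (r - 1) * ‖ω‖ ^ (r - 1) := by
      rw [← Real.mul_rpow hα.le (norm_nonneg _), hωn, ← Real.rpow_mul (norm_nonneg _), hpr,
        Real.rpow_one]
    have h2 : ‖(α ^ (r - 1))⁻¹ • w‖ = (α ^ (r - 1))⁻¹ * ‖w‖ :=
      norm_smul_of_nonneg (inv_nonneg.2 hαr.le) _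
    refine ⟨?_, ?_⟩
    · rw [h2, map_smul, hωr, smul_eq_mul]; ring
    · rw [h2, h1, inv_mul_cancel_left₀ hαr.ne']
  have hmono : (ωd - ω) w ≤ α ^ (r - 1) * (ωd - ω) J := by
    have h := apply_le_apply_of_mem_adjointDualityMap hp.symm.lt.le hJ hwJ
    rwa [map_smul, smul_eq_mul, inv_mul_le_iff₀ hαr] at h
  let d : ℝ := (R xd).toReal - (R x).toReal - ω w
  have hd : dualBregman R xd (ω.comp A) (ωd.comp A) = (d : EReal) := by
    rw [dualBregman, dualFunctional_eq_of_mem_subdifferential hω,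
      dualFunctional_eq_of_mem_subdifferential hωd, ← EReal.coe_sub, ← EReal.coe_sub]
    congr 1
    simp [d, hw]
    ring
  have hd0 : 0 ≤ d := by
    have h := toReal_add_le_of_mem_subdifferential hω hωd.1
    simp only [ContinuousLinearMap.comp_apply, map_sub] at h
    simp only [d, hw, map_sub]
    linarith
  have hΦd := hΦ ω (by simp [hd])
  rw [hd, EReal.toReal_coe] at hΦd
  refine ⟨d, hd0, ?_⟩
  rw [bregman, ← EReal.coe_ennreal_toReal hωd.1, ← EReal.coe_ennreal_toReal hω.1,
    ← EReal.coe_sub, ← EReal.coe_sub, EReal.coe_le_coe_iff]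
  have h6 := mul_le_mul_of_nonneg_left hΦd hαr.le
  have h7 : (ωd.comp A) (x - xd) = -ωd w := by simp [hw]
  simp only [sub_apply] at hmono h6
  rw [h7]
  simp only [d] at h6 ⊢
  linarith

end

theorem le_conjugate_indexInverse (Φ : ℝ → ℝ) (s : ℝ) {d : ℝ} (hd : 0 ≤ d) :
    ((s * Φ d - d : ℝ) : EReal) ≤ conjugate (indexInverse Φ) s := by
  refine le_iSup_of_le (Φ d) ?_
  rw [EReal.coe_sub]
  exact EReal.sub_le_sub le_rfl (iInf₂_le d ⟨hd, rfl⟩)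

/-- Young's inequality for the factors `s c r ^ (-1/r)` and `(r d) ^ (1/r)`: this scaling makes the
second Young term exactly `d`, so it cancels. -/
theorem mul_rpow_sub_le {c s d q r : ℝ} (hc : 0 ≤ c) (hs : 0 ≤ s) (hd : 0 ≤ d)
    (hq : q.HolderConjugate r) :
    s * (c * d ^ (1 / r)) - d ≤ c ^ q * r ^ (1 - q) / q * s ^ q := by
  have hr := hq.symm.pos
  have h := Real.young_inequality_of_nonneg (a := s * c * r ^ (-(1 / r))) (b := (r * d) ^ (1 / r))
    (by positivity) (by positivity) hq
  have h1 : ((r * d) ^ (1 / r)) ^ r / r = d := by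
    rw [← Real.rpow_mul (by positivity), one_div_mul_cancel hr.ne', Real.rpow_one]
    field_simp
  have h2 : (s * c * r ^ (-(1 / r))) ^ q / q = c ^ q * r ^ (1 - q) / q * s ^ q := by
    rw [Real.mul_rpow (by positivity) (by positivity), Real.mul_rpow hs hc,
      ← Real.rpow_mul hr.le]
    have : -(1 / r) * q = 1 - q := by
      have := hq.div_conj_eq_sub_one
      rw [neg_mul, one_div_mul_eq_div, this]; ring
    rw [this]; ring
  have h3 : s * c * r ^ (-(1 / r)) * (r * d) ^ (1 / r) = s * (c * d ^ (1 / r)) := by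
    rw [Real.mul_rpow hr.le hd, Real.rpow_neg hr.le]
    have : r ^ (1 / r) ≠ 0 := (Real.rpow_pos_of_pos hr _).ne'
    field_simp
  rw [h1, h2, h3] at h
  linarith

end TikhonovBanach

theorem mainTheorem4
    {X Y : Type*} [NormedAddCommGroup X] [NormedSpace ℝ X] [CompleteSpace X]
    [NormedAddCommGroup Y] [NormedSpace ℝ Y] [CompleteSpace Y]
    (A : X →L[ℝ] Y) (R : X → ENNReal) (hR : TikhonovBanach.IsRegulariser R)
    (p pStar : ℝ) (hp : p.HolderConjugate pStar)
    (hY : TikhonovBanach.IsPowerSmooth Y p)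
    (yd : Y) (xd : X) (hxd : TikhonovBanach.IsMinimisingSolution A R yd xd)
    (ωd : StrongDual ℝ Y) (hωd : ωd.comp A ∈ TikhonovBanach.subdifferential R xd)
    (Φ : ℝ → ℝ) (hΦ : TikhonovBanach.IsIndexFunction Φ)
    (hvar : TikhonovBanach.DualVariationalInequality A R pStar xd ωd Φ) :
    (∀ (α : ℝ) (xα : X), 0 < α → TikhonovBanach.IsTikhonovMinimiser A R p α yd xα →
      TikhonovBanach.bregman R (ωd.comp A) xα xd ≤
        TikhonovBanach.conjugate (TikhonovBanach.indexInverse Φ) (α ^ (pStar - 1))) ∧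
    (∀ c q qStar : ℝ, 0 < c → q.HolderConjugate qStar →
      (∀ t : ℝ, 0 ≤ t → Φ t = c * t ^ (1 / qStar)) →
      ∀ (α : ℝ) (xα : X), 0 < α → TikhonovBanach.IsTikhonovMinimiser A R p α yd xα →
        TikhonovBanach.bregman R (ωd.comp A) xα xd ≤
          ((c ^ q * qStar ^ (1 - q) / q * α ^ ((pStar - 1) * q) : ℝ) : EReal)) := by
  obtain ⟨rfl, -⟩ := hxd
  refine ⟨fun α xα hα hxα => ?_, fun c q qStar hc hq hΦc α xα hα hxα => ?_⟩
  · obtain ⟨d, hd, h⟩ := TikhonovBanach.exists_bregman_le hR.convex hp hωd hvar hα hxα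
    exact h.trans (TikhonovBanach.le_conjugate_indexInverse Φ _ hd)
  · obtain ⟨d, hd, h⟩ := TikhonovBanach.exists_bregman_le hR.convex hp hωd hvar hα hxα
    refine h.trans (EReal.coe_le_coe_iff.2 ?_)
    rw [hΦc d hd, Real.rpow_mul hα.le]
    exact TikhonovBanach.mul_rpow_sub_le hc.le (Real.rpow_nonneg hα.le _) hd hq
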